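/- Let $T$ be a complete first-order theory and work in a monster model $\mathfrak U$ of $T$; variables and parameters are finite tuples. For a class $\mathcal K$ of finite posets, a partitioned formula $\psi(x;y)$ has $\mathsf{SOP}_{\mathcal K}$ if for every $(\sigma,\le)\in\mathcal K$ there are tuples $(d^s\mid s\in\sigma)$ in $\mathfrak U^{|y|}$ such that, for all $s,t\in\sigma$, $\mathfrak U\models\forall x\,(\psi(x;d^{s})\to\psi(x;d^{t}))$ if and only if $s\le t$. The theory $T$ has $\mathsf{SOP}_{\mathcal K}$ if some partitioned formula does. For a poset $\Sigma$, $\mathsf{SOP}_\Sigma$ means $\mathsf{SOP}_{\mathcal K}$ for $\mathcal K$ the class of finite posets embeddable in $\Sigma$. The \emph{strict universal-order property} $\mathsf{SUP}$ is $\mathsf{SOP}_{\mathcal K}$ for $\mathcal K$ the class of all finite posets. As usual, $T$ has $\mathsf{SOP}$ if some model of $T$ interprets a poset into which $\omega$ embeds. The other properties are the standard ones; $T$ has a property if some formula does. A formula $\varphi(x;y)$ has $\mathsf{IP}$ if there are $(a_i)_{i<\omega}$, $(b_W)_{W\subseteq\omega}$ with $\models\varphi(a_i;b_W)\iff i\in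 W$. A formula $\varphi(x;y_0,y_1)$ has $\mathsf{IP}_2$ if there are $(b_i)_{i<\omega}$, $(c_j)_{j<\omega}$, $(a_W)_{W\subseteq\omega^2}$ with $\models\varphi(a_W;b_i,c_j)\iff (i,j)\in W$; $\mathsf{NIP}_2$ is its negation. A formula $\varphi(x;y)$ has $\mathsf{TP}_1$, $\mathsf{TP}_2$, $\mathsf{ATP}$ if there are $(b^j)_{j\in J}$ such that $\{\varphi(x;b^j)\mid j\in C\}$ is consistent for all $C$ in a family $\mathcal C$ and inconsistent for all pairs in a family $\mathcal I$, where: for $\mathsf{TP}_1$, $J=\omega^{<\omega}$, $\mathcal C$ is the set of branches and $\mathcal I$ of pairs of incomparable nodes; for $\mathsf{TP}_2$, $J=\omega\times\omega$, $\mathcal C$ is the set of graphs of functions $f\colon\omega\to\omega$ and $\mathcal I$ of pairs $\{(i,j),(i,k)\}$ with $j\ne k$; for $\mathsf{ATP}$, $J=2^{<\omega}$, $\mathcal C$ is the set of antichains and $\mathcal I$ of pairs of distinct comparable nodes. (1) For every complete theory $T$ the following are equivalent: $T$ has $\mathsf{SOP}$; $T$ has $\mathsf{SOP}_{\mathcal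 K}$ for $\mathcal K$ the class of finite linear orders; $T$ has $\mathsf{SOP}_\Sigma$ for some infinite linear order $\Sigma$; $T$ has $\mathsf{SOP}_\Sigma$ for every infinite linear order $\Sigma$. (2) If a formula, or a complete theory, has $\mathsf{SUP}$, then it has $\mathsf{SOP}_{\mathcal K'}$ for every class $\mathcal K'$ of finite posets. If a complete theory $T$ has $\mathsf{SUP}$, then $T$ has the strict order property $\mathsf{SOP}$, the tree property of the first kind $\mathsf{TP}_1$, the antichain tree property $\mathsf{ATP}$, the tree property of the second kind $\mathsf{TP}_2$ and the independence property $\mathsf{IP}$. (3) The class of all finite posets, in the language $\{\le\}$, is a Fraïssé class and has a Fraïssé limit (the generic poset). The complete theory of the generic poset eliminates quantifiers in $\{\le\}$, has $\mathsf{SUP}$, and does not have the $2$-independence property $\mathsf{IP}_2$, i.e. it is $\mathsf{NIP}_2$. (4) Consequently, for no class $\mathcal K$ of finite posets does $\mathsf{SOP}_{\mathcal K}$ imply $\mathsf{IP}_2$: for every such $\mathcal K$ there is a complete theory that has $\mathsf{SOP}_{\mathcal K}$ and is $\mathsf{NIP}_2$. -/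

import Mathlib

universe u v w

/- A complete theory `T` is studied inside a monster model.  A small configuration of finite tuples
occurs in the monster model if and only if it occurs in some model of `T`, so "there are tuples in
the monster model" is written "there are a model `M` of `T` and tuples in `M`"; accordingly a set of
formulas over `M` is consistent when it is finitely satisfiable in `M`.
A partitioned formula `φ(x; y)` is an element of `L.Formula (Fin n ⊕ Fin m)`. -/

namespace FirstOrder.Language

variable {L : Language.{u, v}}

namespace Theory

/-- The partitioned formula `ψ(x; y)` has `SOP_K` with respect to `T`, for a class `K` of finite
posets. -/
def FormulaHasSOPFor (T : L.Theory) (K : Set FinPartOrd.{w}) {n m : ℕ}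
    (ψ : L.Formula (Fin n ⊕ Fin m)) : Prop :=
  ∃ M : ModelType.{u, v, max u v} T, ∀ σ ∈ K, ∃ d : σ → Fin m → M, ∀ s t : σ,
    (∀ x : Fin n → M, ψ.Realize (Sum.elim x (d s)) → ψ.Realize (Sum.elim x (d t))) ↔ s ≤ t

/-- `T` has `SOP_K`. -/
def HasSOPFor (T : L.Theory) (K : Set FinPartOrd.{w}) : Prop :=
  ∃ (n m : ℕ) (ψ : L.Formula (Fin n ⊕ Fin m)), T.FormulaHasSOPFor K ψ

/-- The class of finite posets that embed into the poset `S`. -/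
def posetAge (S : Type w) [PartialOrder S] : Set FinPartOrd.{w} :=
  {σ | Nonempty (σ ↪o S)}

/-- `T` has `SOP_S` for a poset `S`. -/
def HasSOPOf (T : L.Theory) (S : Type w) [PartialOrder S] : Prop :=
  T.HasSOPFor (posetAge S)

/-- The class of finite linear orders. -/
def finiteLinearOrders : Set FinPartOrd.{0} :=
  {σ | ∀ s t : σ, s ≤ t ∨ t ≤ s}

/-- The strict universal-order property: `SOP_K` for the class `K` of all finite posets. -/
def HasSUP (T : L.Theory) : Prop :=
  T.HasSOPFor (Set.univ : Set FinPartOrd.{0})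

/-- The poset `P` is (isomorphic to) a poset interpreted, with parameters, in the structure `M`:
it is the quotient of a definable set `D` of `n`-tuples by an equivalence relation, with the pullback
of its order to `D` definable. -/
def InterpretsPoset (L : Language.{u, v}) (M : Type*) [L.Structure M]
    (P : Type*) [PartialOrder P] : Prop :=
  ∃ (n : ℕ) (D : Set (Fin n → M)) (f : D → P), Function.Surjective f ∧
    (Set.univ : Set M).Definable L D ∧
    (Set.univ : Set M).Definable L
      {v : Fin n ⊕ Fin n → M | ∃ a b : D, a.1 = v ∘ Sum.inl ∧ b.1 = v ∘ Sum.inr ∧ f a ≤ f b}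

/-- The strict order property: some model interprets a poset into which `ω` embeds. -/
def HasSOP (T : L.Theory) : Prop :=
  ∃ (M : ModelType.{u, v, max u v} T) (P : Type (max u v)) (_ : PartialOrder P),
    InterpretsPoset L M P ∧ Nonempty (ℕ ↪o P)

/-- The set of formulas `{φ(x; b j) | j ∈ C}` is consistent (finitely satisfiable in `M`). -/
def ConsistentOn {M : Type*} [L.Structure M] {n m : ℕ} (φ : L.Formula (Fin n ⊕ Fin m))
    {J : Type*} (b : J → Fin m → M) (C : Set J) : Prop :=
  ∀ F : Finset J, (F : Set J) ⊆ C → ∃ a : Fin n → M, ∀ j ∈ F, φ.Realize (Sum.elim a (b j))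

/-- `T` has the tree property given by the consistent sets `𝒞` and the inconsistent sets `ℐ`. -/
def HasTreeProperty (T : L.Theory) {J : Type*} (𝒞 ℐ : Set (Set J)) : Prop :=
  ∃ (n m : ℕ) (φ : L.Formula (Fin n ⊕ Fin m)) (M : ModelType.{u, v, max u v} T)
    (b : J → Fin m → M),
    (∀ C ∈ 𝒞, ConsistentOn φ b C) ∧ (∀ I ∈ ℐ, ¬ ConsistentOn φ b I)

/-- `TP₁`: index set the tree `ω^{<ω}` (a node is the list of its entries, root side first); branches
are consistent, pairs of incomparable nodes are inconsistent. -/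
def HasTP₁ (T : L.Theory) : Prop :=
  T.HasTreeProperty (J := List ℕ)
    {C | ∃ f : ℕ → ℕ, C = {η | ∃ k, η = (List.range k).map f}}
    {I | ∃ η ν : List ℕ, ¬ η <+: ν ∧ ¬ ν <+: η ∧ I = {η, ν}}

/-- `TP₂`: index set the array `ω × ω`; paths are consistent, pairs of distinct elements of the same
row are inconsistent. -/
def HasTP₂ (T : L.Theory) : Prop :=
  T.HasTreeProperty (J := ℕ × ℕ)
    {C | ∃ f : ℕ → ℕ, C = {p | p.2 = f p.1}}
    {I | ∃ i j k : ℕ, j ≠ k ∧ I = {(i, j), (i, k)}}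

/-- `ATP`: index set the tree `2^{<ω}`; antichains are consistent, pairs of distinct comparable nodes
are inconsistent. -/
def HasATP (T : L.Theory) : Prop :=
  T.HasTreeProperty (J := List Bool)
    {C | IsAntichain (· <+: ·) C}
    {I | ∃ η ν : List Bool, η <+: ν ∧ η ≠ ν ∧ I = {η, ν}}

/-- The independence property. -/
def HasIP (T : L.Theory) : Prop :=
  ∃ (n m : ℕ) (φ : L.Formula (Fin n ⊕ Fin m)) (M : ModelType.{u, v, max u v} T)
    (a : ℕ → Fin n → M) (b : Set ℕ → Fin m → M),
    ∀ i W, φ.Realize (Sum.elim (a i) (b W)) ↔ i ∈ W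

/-- The `k`-independence property `IP_k` (for `k ≥ 1`): some formula `φ(x; y_0, …, y_{k-1})`, where
`y_j` is a tuple of length `m j`, shatters a product of `k` sequences of tuples. -/
def HasIPk (k : ℕ) (T : L.Theory) : Prop :=
  ∃ (n : ℕ) (m : Fin k → ℕ) (φ : L.Formula (Fin n ⊕ (Σ j : Fin k, Fin (m j))))
    (M : ModelType.{u, v, max u v} T)
    (b : (j : Fin k) → ℕ → Fin (m j) → M) (a : Set (Fin k → ℕ) → Fin n → M),
    ∀ (W : Set (Fin k → ℕ)) (i : Fin k → ℕ),
      φ.Realize (Sum.elim (a W) (fun p => b p.1 (i p.1) p.2)) ↔ i ∈ W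

/-- `T` eliminates quantifiers. -/
def HasQE (T : L.Theory) : Prop :=
  ∀ (n : ℕ) (φ : L.Formula (Fin n)), ∃ ψ : L.Formula (Fin n), ψ.IsQF ∧ T ⊨ᵇ φ.iff ψ

end Theory

/-- The class of all finite posets, as structures in the language `{≤}`. -/
def finitePosets : Set (CategoryTheory.Bundled.{0} Language.order.Structure) :=
  {S | Finite S ∧ S ⊨ Language.order.partialOrderTheory}

end FirstOrder.Language

/-!
For a formula `ψ(x; y)` the relation `∀ x, ψ(x; y) → ψ(x; y')` is a definable preorder on tuples
(`impFormula`), and `SOP_K` says that the posets of `K` embed into it. Compactness passes from the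
finite posets to infinite ones (`FormulaHasSOPFor.exists_model`).

Applied to `ω`, this yields an interpreted poset with an infinite chain, which is `SOP`; conversely an
interpreted chain gives the formula "`x ≤ y`" with `SOP_K` for the finite linear orders. Since every
finite linear order embeds into every infinite one, it makes no difference which infinite linear
order is used (`hasSOP_tfae`).

Under `SUP` every poset embeds into the definable preorder of `ψ` in some model. Given any relation
of incompatibility on an index set `J`, there is a poset with intervals `[a_j, b_j]`, `j ∈ J`, in which
`a_i ≤ b_j` fails for incompatible `i`, `j`, and in which each finite set of pairwise compatible
intervals has a common point (`IntervalPoset`). The formula `y ≤ x ≤ z` then has the consistency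
pattern prescribed by the relation, which gives `TP₁`, `TP₂` and `ATP` at once
(`HasSUP.hasTreeProperty`); `IP` comes from the poset of points and sets ordered by membership.

The generic poset is a countable poset in which every one-point extension of a finite subposet is
realized. It is the union of a generic directed family of finite approximations
(`OrderCondition.exists_hasPointExtensions`), and back-and-forth makes it the Fraïssé limit of the
finite posets; the Fraïssé properties of the class follow. In a Fraïssé limit, ultrahomogeneity shows
that the truth of a formula depends only on the order diagram of a tuple, so there is quantifier
elimination, and `x ≤ y` has `SUP` because every finite poset embeds.

Finally, quantifier elimination in a binary relational language excludes `IP₂` by counting: the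
subset of `N × N` coded by `a` is determined by the `2 N` quantifier-free types of `(a, b_i)` and
`(a, c_j)`, so there are at most `q ^ N` such subsets with `q` constant, fewer than `2 ^ (N * N)` for
`N = q` (`Theory.HasQE.not_hasIPk_two`).
-/

universe w₁ w₂

namespace FirstOrder.Language

variable {L : Language.{u, v}}

namespace Theory

/-! ### Compactness and the definable preorder of a formula -/

/-- Compactness for families of formulas in variables `α`. -/
theorem exists_realize_of_forall_finset {T : L.Theory} {α ι : Type} (Γ : ι → L.Formula α)
    (h : ∀ F : Finset ι, ∃ (M : ModelType.{u, v, max u v} T) (v : α → M),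
      ∀ i ∈ F, (Γ i).Realize v) :
    ∃ (M : ModelType.{u, v, max u v} T) (v : α → M), ∀ i, (Γ i).Realize v := by
  let T' : ι → L[[α]].Theory := fun i =>
    (L.lhomWithConstants α).onTheory T ∪ {Formula.equivSentence (Γ i)}
  rcases isEmpty_or_nonempty ι with hι | hι
  · obtain ⟨M, v, -⟩ := h ∅
    exact ⟨M, v, fun i => hι.elim i⟩
  have hT' : IsSatisfiable (⋃ i, T' i) := by
    rw [isSatisfiable_iUnion_iff_isSatisfiable_iUnion_finset]
    intro F
    obtain ⟨M, v, hv⟩ := h F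
    let : (constantsOn α).Structure M := constantsOn.structure v
    have hM : M ⊨ ⋃ i ∈ F, T' i := by
      simp only [model_iff, Set.mem_iUnion, T', Set.mem_union, Set.mem_singleton_iff]
      rintro φ ⟨i, hi, hφ | rfl⟩
      · exact (model_iff _).1 ((LHom.onTheory_model _ T).2 M.is_model) φ hφ
      · exact (Formula.realize_equivSentence M (Γ i)).2 (hv i hi)
    exact Model.isSatisfiable M
  obtain ⟨M⟩ := hT'
  have hsub : (L.lhomWithConstants α).onTheory T ⊆ ⋃ i, T' i := fun φ hφ =>
    Set.mem_iUnion.2 ⟨hι.some, Or.inl hφ⟩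
  refine ⟨(M.subtheoryModel hsub).reduct (L.lhomWithConstants α), fun a => (L.con a : M), ?_⟩
  intro i
  have hi : M ⊨ Formula.equivSentence (Γ i) :=
    Theory.realize_sentence_of_mem (⋃ i, T' i) (Set.mem_iUnion.2 ⟨i, Or.inr rfl⟩)
  have := (@Formula.realize_equivSentence_symm_con L M ((L.lhomWithConstants α).reduct M) α M.struc
    (LHom.isExpansionOn_reduct _ M) (Formula.equivSentence (Γ i))).2 hi
  rwa [_root_.Equiv.symm_apply_apply] at this

/-- For a partitioned formula `ψ(x; y)`, the formula `∀ x, ψ(x; y) → ψ(x; y')`, which defines a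
preorder on tuples. -/
noncomputable def impFormula {n m : ℕ} (ψ : L.Formula (Fin n ⊕ Fin m)) :
    L.Formula (Fin m ⊕ Fin m) :=
  Formula.iAlls (Fin n)
    ((ψ.relabel (Sum.elim Sum.inr fun i => Sum.inl (Sum.inl i))).imp
      (ψ.relabel (Sum.elim Sum.inr fun i => Sum.inl (Sum.inr i))))

theorem realize_impFormula {n m : ℕ} (ψ : L.Formula (Fin n ⊕ Fin m)) {M : Type*} [L.Structure M]
    (c d : Fin m → M) :
    (impFormula ψ).Realize (Sum.elim c d) ↔
      ∀ x : Fin n → M, ψ.Realize (Sum.elim x c) → ψ.Realize (Sum.elim x d) := by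
  simp only [impFormula, Formula.realize_iAlls, Formula.realize_imp, Formula.realize_relabel]
  refine forall_congr' fun x => ?_
  have h₁ : (fun a => Sum.elim (Sum.elim c d) x a) ∘
      (Sum.elim Sum.inr fun i => Sum.inl (Sum.inl i)) = Sum.elim x c := by
    ext i; cases i <;> rfl
  have h₂ : (fun a => Sum.elim (Sum.elim c d) x a) ∘
      (Sum.elim Sum.inr fun i => Sum.inl (Sum.inr i)) = Sum.elim x d := by
    ext i; cases i <;> rfl
  rw [← h₁, ← h₂]

/-- `SOP_K` passes to every class all of whose members embed into members of `K`; the two classes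
may live in different universes. -/
theorem FormulaHasSOPFor.mono {T : L.Theory} {K : Set FinPartOrd.{w₁}}
    {K' : Set FinPartOrd.{w₂}} {n m : ℕ} {ψ : L.Formula (Fin n ⊕ Fin m)}
    (h : T.FormulaHasSOPFor K ψ)
    (hK : ∀ σ ∈ K', ∃ τ ∈ K, Nonempty (σ ↪o τ)) : T.FormulaHasSOPFor K' ψ := by
  obtain ⟨M, hM⟩ := h
  refine ⟨M, fun σ hσ => ?_⟩
  obtain ⟨τ, hτ, ⟨e⟩⟩ := hK σ hσ
  obtain ⟨d, hd⟩ := hM τ hτ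
  exact ⟨d ∘ e, fun s t => (hd (e s) (e t)).trans e.le_iff_le⟩

theorem HasSOPFor.mono {T : L.Theory} {K : Set FinPartOrd.{w₁}}
    {K' : Set FinPartOrd.{w₂}} (h : T.HasSOPFor K)
    (hK : ∀ σ ∈ K', ∃ τ ∈ K, Nonempty (σ ↪o τ)) : T.HasSOPFor K' := by
  obtain ⟨n, m, ψ, hψ⟩ := h
  exact ⟨n, m, ψ, hψ.mono hK⟩

/-- Every finite poset has a copy in any other universe. -/
theorem exists_orderIso_finPartOrd (σ : FinPartOrd.{w₁}) :
    ∃ τ : FinPartOrd.{w₂}, Nonempty (σ ≃o τ) := by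
  let e : ULift.{w₂} (Fin (Fintype.card σ)) ≃ σ := Equiv.ulift.trans (Fintype.equivFin σ).symm
  let : PartialOrder (ULift.{w₂} (Fin (Fintype.card σ))) := PartialOrder.lift e e.injective
  exact ⟨FinPartOrd.of (ULift.{w₂} (Fin (Fintype.card σ))), ⟨⟨e.symm, by
    intro a b
    change e (e.symm a) ≤ e (e.symm b) ↔ a ≤ b
    simp⟩⟩⟩

/-- A formula with `SOP_K` orders, in some model, a family of tuples like `Q`, for every poset `Q`
whose finite subposets lie in `K`. -/
theorem FormulaHasSOPFor.exists_model {T : L.Theory} {K : Set FinPartOrd.{0}} {n m : ℕ}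
    {ψ : L.Formula (Fin n ⊕ Fin m)} (h : T.FormulaHasSOPFor K ψ) (Q : Type) [PartialOrder Q]
    (hQ : ∀ F : Finset Q, FinPartOrd.of F ∈ K) :
    ∃ (M : ModelType.{u, v, max u v} T) (d : Q → Fin m → M), ∀ s t : Q,
      (impFormula ψ).Realize (Sum.elim (d s) (d t)) ↔ s ≤ t := by
  classical
  let θ : Q × Q → L.Formula (Q × Fin m) := fun p =>
    (impFormula ψ).relabel (Sum.elim (fun i => (p.1, i)) fun i => (p.2, i))
  have hθ : ∀ (M : ModelType.{u, v, max u v} T) (e : Q × Fin m → M) (p : Q × Q),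
      (θ p).Realize e ↔ (impFormula ψ).Realize
        (Sum.elim (fun i => e (p.1, i)) (fun i => e (p.2, i))) := by
    intro M e p
    rw [Formula.realize_relabel]
    congr! 1
    ext i
    cases i <;> rfl
  obtain ⟨M, e, he⟩ := exists_realize_of_forall_finset (T := T)
    (fun p : Q × Q => if p.1 ≤ p.2 then θ p else (θ p).not) (by
      intro F
      obtain ⟨M, hM⟩ := h
      let A : Finset Q := F.image Prod.fst ∪ F.image Prod.snd
      obtain ⟨d, hd⟩ := hM _ (hQ A)
      refine ⟨M, fun q => if hq : q.1 ∈ A then d ⟨q.1, hq⟩ q.2 else Classical.arbitrary M, ?_⟩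
      intro p hp
      have h₁ : p.1 ∈ A := Finset.mem_union_left _ (Finset.mem_image_of_mem _ hp)
      have h₂ : p.2 ∈ A := Finset.mem_union_right _ (Finset.mem_image_of_mem _ hp)
      have key := hd ⟨p.1, h₁⟩ ⟨p.2, h₂⟩
      rw [← realize_impFormula] at key
      split_ifs with hle
      · rw [hθ]
        simp only [h₁, h₂, dif_pos]
        exact key.2 hle
      · rw [Formula.realize_not, hθ]
        simp only [h₁, h₂, dif_pos]
        exact fun hc => hle (key.1 hc))
  refine ⟨M, fun q i => e (q, i), fun s t => ?_⟩
  have := he (s, t)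
  split_ifs at this with hle
  · exact iff_of_true ((hθ M e (s, t)).1 this) hle
  · exact iff_of_false (fun hc => Formula.realize_not.1 this ((hθ M e (s, t)).2 hc)) hle

/-! ### Linear orders and the strict order property -/

theorem exists_orderEmbedding_of_total (σ : FinPartOrd.{w₁})
    (hσ : ∀ s t : σ, s ≤ t ∨ t ≤ s) (S : Type w₂) [LinearOrder S] [Infinite S] :
    Nonempty (σ ↪o S) := by
  classical
  let : LinearOrder σ :=
    { (inferInstance : PartialOrder σ) with
      le_total := hσ
      toDecidableLE := Classical.decRel _ }
  exact nonempty_orderEmbedding_of_finite_infinite σ S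

/-- Compactness gives an infinite chain of tuples, and the interpreted poset is the quotient of the
definable preorder by its equivalence relation. -/
theorem hasSOP_of_finiteLinearOrders {T : L.Theory} (h : T.HasSOPFor finiteLinearOrders) :
    T.HasSOP := by
  obtain ⟨n, m, ψ, hψ⟩ := h
  obtain ⟨M, d, hd⟩ := hψ.exists_model ℕ fun F s t => le_total s.1 t.1
  let : Preorder (Fin m → M) :=
    { le := fun c d => (impFormula ψ).Realize (Sum.elim c d)
      le_refl := fun c => (realize_impFormula ψ c c).2 fun _ => id
      le_trans := fun a b c hab hbc => (realize_impFormula ψ a c).2 fun x hx =>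
        (realize_impFormula ψ b c).1 hbc x ((realize_impFormula ψ a b).1 hab x hx) }
  refine ⟨M, Antisymmetrization (Fin m → M) (· ≤ ·), inferInstance,
    ⟨m, Set.univ, fun a => toAntisymmetrization (· ≤ ·) a.1, ?_, Set.definable_univ, ?_⟩,
    ⟨⟨⟨fun k => toAntisymmetrization (· ≤ ·) (d k), ?_⟩, ?_⟩⟩⟩
  · intro q
    induction q using Antisymmetrization.ind with
    | _ a => exact ⟨⟨a, trivial⟩, rfl⟩
  · refine Set.Definable.mono ?_ (Set.empty_subset _)
    rw [Set.empty_definable_iff]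
    refine ⟨impFormula ψ, Set.ext fun v => ⟨?_, fun hv => ?_⟩⟩
    · rintro ⟨a, b, ha, hb, hab⟩
      rw [toAntisymmetrization_le_toAntisymmetrization_iff] at hab
      change (impFormula ψ).Realize _ at hab
      rwa [ha, hb, Sum.elim_comp_inl_inr] at hab
    · refine ⟨⟨v ∘ Sum.inl, trivial⟩, ⟨v ∘ Sum.inr, trivial⟩, rfl, rfl, ?_⟩
      rw [toAntisymmetrization_le_toAntisymmetrization_iff]
      change (impFormula ψ).Realize _
      rwa [Sum.elim_comp_inl_inr]
  · intro s t hst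
    have hst := Quotient.exact hst
    exact le_antisymm ((hd s t).1 hst.1) ((hd t s).1 hst.2)
  · intro s t
    exact (toAntisymmetrization_le_toAntisymmetrization_iff (α := Fin m → M)).trans (hd s t)

/-- The formula `ψ(x; y, z)` says `x ≤ y` in the interpreted poset, where `z` holds the parameters of
the interpretation: for `y` in a chain, its instances form a chain of principal lower sets. -/
theorem HasSOP.finiteLinearOrders {T : L.Theory} (h : T.HasSOP) :
    T.HasSOPFor finiteLinearOrders := by
  obtain ⟨M, P, _, ⟨n, D, f, hf, -, hdef⟩, ⟨e⟩⟩ := h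
  obtain ⟨A, -, hA⟩ := Set.definable_iff_finitely_definable.1 hdef
  obtain ⟨φ, hφ⟩ := Set.definable_iff_exists_formula_sum.1 hA
  let g := Fintype.equivFin (A : Set M)
  refine ⟨n, n + Fintype.card (A : Set M), φ.relabel (Sum.elim (fun c => Sum.inr (Fin.natAdd n (g c)))
    (Sum.elim Sum.inl fun i => Sum.inr (Fin.castAdd _ i))), M, fun σ hσ => ?_⟩
  obtain ⟨ι⟩ := exists_orderEmbedding_of_total σ hσ ℕ
  choose a ha using fun k => hf (e k)
  refine ⟨fun s => Fin.append (a (ι s)).1 fun i => (g.symm i).1, fun s t => ?_⟩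
  have key : ∀ (x : Fin n → M) (s : σ),
      (φ.relabel (Sum.elim (fun c => Sum.inr (Fin.natAdd n (g c)))
        (Sum.elim Sum.inl fun i => Sum.inr (Fin.castAdd _ i)))).Realize
        (Sum.elim x (Fin.append (a (ι s)).1 fun i => (g.symm i).1)) ↔
      ∃ b : D, b.1 = x ∧ f b ≤ e (ι s) := by
    intro x s
    have h₁ : (Sum.elim x (Fin.append (a (ι s)).1 fun i => (g.symm i).1)) ∘
        (Sum.elim (fun c => Sum.inr (Fin.natAdd n (g c)))
          (Sum.elim Sum.inl fun i => Sum.inr (Fin.castAdd _ i))) =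
        Sum.elim (fun c : (A : Set M) => (c : M)) (Sum.elim x (a (ι s)).1) := by
      ext i
      rcases i with c | i | i <;> simp
    have h₂ := Set.ext_iff.1 hφ (Sum.elim x (a (ι s)).1)
    rw [Formula.realize_relabel, h₁]
    refine h₂.symm.trans ?_
    simp only [Set.mem_ofPred_eq, Sum.elim_comp_inl, Sum.elim_comp_inr]
    constructor
    · rintro ⟨b, c, hb, hc, hbc⟩
      obtain rfl := Subtype.ext hc
      exact ⟨b, hb, ha (ι s) ▸ hbc⟩
    · rintro ⟨b, hb, hbc⟩
      exact ⟨b, a (ι s), hb, rfl, (ha (ι s)).symm ▸ hbc⟩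
  simp only [key]
  rw [← ι.le_iff_le, ← e.le_iff_le]
  constructor
  · intro hx
    obtain ⟨b, hb, hle⟩ := hx (a (ι s)).1 ⟨a (ι s), rfl, (ha _).le⟩
    obtain rfl := Subtype.ext hb
    rwa [ha] at hle
  · rintro hst x ⟨b, hb, hle⟩
    exact ⟨b, hb, hle.trans hst⟩

/-! ### Consequences of the strict universal-order property -/

/-- The poset that turns a binary relation `R` of incompatibility on `J` into intervals: a lower end
`lower j` and an upper end `upper j` for each `j`, with `lower j ≤ upper k` when `j` and `k` are
compatible, and a common point `point F` of the intervals of each finite set `F` of pairwise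
compatible indices. -/
inductive IntervalPoset {J : Type} (R : J → J → Prop) : Type
  | lower (j : J) : IntervalPoset R
  | point (F : Finset J) (hF : ∀ i ∈ F, ∀ j ∈ F, ¬ R i j) : IntervalPoset R
  | upper (j : J) : IntervalPoset R

namespace IntervalPoset

variable {J : Type} {R : J → J → Prop}

/-- The order of `IntervalPoset R`; distinct points of the same kind are incomparable. -/
protected def le : IntervalPoset R → IntervalPoset R → Prop
  | lower i, lower j => i = j
  | lower i, point F _ => i ∈ F
  | lower i, upper j => ¬ R i j
  | point F _, point G _ => F = G
  | point F _, upper j => j ∈ F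
  | upper i, upper j => i = j
  | _, _ => False

instance : PartialOrder (IntervalPoset R) where
  le := IntervalPoset.le
  le_refl a := by cases a <;> simp [IntervalPoset.le]
  le_trans a b c hab hbc := by
    cases a <;> cases b <;> cases c <;> simp only [IntervalPoset.le] at * <;> grind
  le_antisymm a b hab hba := by
    cases a <;> cases b <;> simp only [IntervalPoset.le] at * <;> grind

end IntervalPoset

/-- With `SUP`, every configuration of consistency and inconsistency that is governed by an
incompatibility relation between pairs is realized by intervals of the definable preorder. -/
theorem HasSUP.hasTreeProperty {T : L.Theory} (h : T.HasSUP) {J : Type} (R : J → J → Prop)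
    {𝒞 ℐ : Set (Set J)} (h𝒞 : ∀ C ∈ 𝒞, ∀ i ∈ C, ∀ j ∈ C, ¬ R i j)
    (hℐ : ∀ I ∈ ℐ, ∃ i ∈ I, ∃ j ∈ I, R i j) : T.HasTreeProperty 𝒞 ℐ := by
  classical
  obtain ⟨n, m, ψ, hψ⟩ := h
  obtain ⟨M, d, hd⟩ := hψ.exists_model (IntervalPoset R) fun _ => trivial
  let φ : L.Formula (Fin m ⊕ Fin (m + m)) :=
    (impFormula ψ).relabel (Sum.elim (fun i => Sum.inr (Fin.castAdd m i)) Sum.inl) ⊓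
      (impFormula ψ).relabel (Sum.elim Sum.inl (fun i => Sum.inr (Fin.natAdd m i)))
  have hφ : ∀ a b c : Fin m → M, φ.Realize (Sum.elim a (Fin.append b c)) ↔
      (impFormula ψ).Realize (Sum.elim b a) ∧ (impFormula ψ).Realize (Sum.elim a c) := by
    intro a b c
    rw [Formula.realize_inf, Formula.realize_relabel, Formula.realize_relabel]
    congr! 2 <;> ext i <;> cases i <;> simp only [Function.comp_apply, Sum.elim_inl, Sum.elim_inr,
      Fin.append_left, Fin.append_right]
  refine ⟨m, m + m, φ, M, fun j => Fin.append (d (.lower j)) (d (.upper j)), ?_, ?_⟩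
  · intro C hC F hF
    have hF' : ∀ i ∈ F, ∀ j ∈ F, ¬ R i j := fun i hi j hj => h𝒞 C hC i (hF hi) j (hF hj)
    refine ⟨d (.point F hF'), fun j hj => (hφ _ _ _).2 ⟨(hd _ _).2 ?_, (hd _ _).2 ?_⟩⟩ <;> exact hj
  · intro I hI hcon
    obtain ⟨i, hi, j, hj, hij⟩ := hℐ I hI
    obtain ⟨a, ha⟩ := hcon {i, j} (by simp [Set.insert_subset_iff, hi, hj])
    have h₁ := (realize_impFormula ψ _ _).1 ((hφ _ _ _).1 (ha i (by simp))).1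
    have h₂ := (realize_impFormula ψ _ _).1 ((hφ _ _ _).1 (ha j (by simp))).2
    have h₃ : (IntervalPoset.lower i : IntervalPoset R) ≤ .upper j :=
      (hd _ _).1 ((realize_impFormula ψ _ _).2 fun x hx => h₂ x (h₁ x hx))
    exact h₃ hij

theorem HasSUP.hasTP₁ {T : L.Theory} (h : T.HasSUP) : T.HasTP₁ := by
  refine h.hasTreeProperty (fun η ν => ¬ η <+: ν ∧ ¬ ν <+: η) ?_ ?_
  · rintro _ ⟨f, rfl⟩ _ ⟨k, rfl⟩ _ ⟨l, rfl⟩ ⟨h₁, h₂⟩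
    have key : ∀ {k l : ℕ}, k ≤ l → (List.range k).map f <+: (List.range l).map f := by
      intro k l hkl
      obtain ⟨p, rfl⟩ := Nat.exists_eq_add_of_le hkl
      rw [List.range_add]
      exact (List.prefix_append _ _).map f
    rcases le_total k l with hkl | hkl
    · exact h₁ (key hkl)
    · exact h₂ (key hkl)
  · rintro _ ⟨η, ν, h₁, h₂, rfl⟩
    exact ⟨η, by simp, ν, by simp, h₁, h₂⟩

theorem HasSUP.hasATP {T : L.Theory} (h : T.HasSUP) : T.HasATP := by
  refine h.hasTreeProperty (fun η ν => η <+: ν ∧ η ≠ ν) ?_ ?_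
  · exact fun C hC i hi j hj hij => hC hi hj hij.2 hij.1
  · rintro _ ⟨η, ν, h₁, h₂, rfl⟩
    exact ⟨η, by simp, ν, by simp, h₁, h₂⟩

theorem HasSUP.hasTP₂ {T : L.Theory} (h : T.HasSUP) : T.HasTP₂ := by
  refine h.hasTreeProperty (fun p q => p.1 = q.1 ∧ p.2 ≠ q.2) ?_ ?_
  · rintro _ ⟨f, rfl⟩ p hp q hq ⟨h₁, h₂⟩
    simp only [Set.mem_ofPred_eq] at hp hq
    exact h₂ (by rw [hp, hq, h₁])
  · rintro _ ⟨i, j, k, hjk, rfl⟩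
    exact ⟨(i, j), by simp, (i, k), by simp, rfl, hjk⟩

/-- The poset of height two formed by `ℕ` below its power set, ordered by membership. -/
inductive MemPoset : Type
  | elem (i : ℕ) : MemPoset
  | set (W : Set ℕ) : MemPoset

/-- The order of `MemPoset`. -/
protected def MemPoset.le : MemPoset → MemPoset → Prop
  | elem i, elem j => i = j
  | elem i, set W => i ∈ W
  | set V, set W => V = W
  | set _, elem _ => False

instance : PartialOrder MemPoset where
  le := MemPoset.le
  le_refl a := by cases a <;> simp [MemPoset.le]
  le_trans a b c hab hbc := by
    cases a <;> cases b <;> cases c <;> simp only [MemPoset.le] at * <;> grind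
  le_antisymm a b hab hba := by
    cases a <;> cases b <;> simp only [MemPoset.le] at * <;> grind

theorem HasSUP.hasIP {T : L.Theory} (h : T.HasSUP) : T.HasIP := by
  obtain ⟨n, m, ψ, hψ⟩ := h
  obtain ⟨M, d, hd⟩ := hψ.exists_model MemPoset fun _ => trivial
  exact ⟨m, m, impFormula ψ, M, fun i => d (.elem i), fun W => d (.set W),
    fun i W => hd (.elem i) (.set W)⟩

theorem FormulaHasSOPFor.of_univ {T : L.Theory} {n m : ℕ} {ψ : L.Formula (Fin n ⊕ Fin m)}
    (h : T.FormulaHasSOPFor (Set.univ : Set FinPartOrd.{0}) ψ) (K : Set FinPartOrd.{w}) :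
    T.FormulaHasSOPFor K ψ :=
  h.mono fun σ _ =>
    let ⟨τ, ⟨e⟩⟩ := exists_orderIso_finPartOrd.{w, 0} σ
    ⟨τ, trivial, ⟨e.toOrderEmbedding⟩⟩

theorem HasSUP.hasSOPFor {T : L.Theory} (h : T.HasSUP) (K : Set FinPartOrd.{w}) :
    T.HasSOPFor K := by
  obtain ⟨n, m, ψ, hψ⟩ := h
  exact ⟨n, m, ψ, hψ.of_univ K⟩

theorem HasSUP.hasSOP {T : L.Theory} (h : T.HasSUP) : T.HasSOP :=
  hasSOP_of_finiteLinearOrders (h.hasSOPFor _)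

theorem hasSOP_tfae (T : L.Theory) :
    [ T.HasSOP,
      T.HasSOPFor finiteLinearOrders,
      ∃ (S : Type w) (_ : LinearOrder S), Infinite S ∧ T.HasSOPOf S,
      ∀ (S : Type w) [LinearOrder S] [Infinite S], T.HasSOPOf S ].TFAE := by
  tfae_have 1 → 2 := HasSOP.finiteLinearOrders
  tfae_have 2 → 1 := hasSOP_of_finiteLinearOrders
  tfae_have 2 → 4 := fun h S _ _ => h.mono fun σ ⟨e⟩ =>
    let ⟨τ, ⟨g⟩⟩ := exists_orderIso_finPartOrd.{w, 0} σ
    ⟨τ, fun s t => (le_total (e (g.symm s)) (e (g.symm t))).imp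
      (fun h => by simpa using h) (fun h => by simpa using h), ⟨g.toOrderEmbedding⟩⟩
  tfae_have 4 → 3 := fun h => ⟨ULift ℕ, inferInstance, inferInstance, h (ULift ℕ)⟩
  tfae_have 3 → 2 := fun ⟨S, _, _, h⟩ => h.mono fun σ hσ =>
    let ⟨τ, ⟨g⟩⟩ := exists_orderIso_finPartOrd.{0, w} σ
    let ⟨e⟩ := exists_orderEmbedding_of_total σ hσ S
    ⟨τ, ⟨g.symm.toOrderEmbedding.trans e⟩, ⟨g.toOrderEmbedding⟩⟩
  tfae_finish

end Theory
end FirstOrder.Language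

namespace FirstOrder.Language

open Structure Substructure

/-! ### A countable poset with the extension property -/

/-- The extension property of a poset `N`: over every finite set `A`, every admissible pair of a
lower part `D` and an upper part `U` of `A` is cut out by a point of `N`.  It says that every
one-point extension of a finite subposet is realized in `N`. -/
def HasPointExtensions (N : Type*) [PartialOrder N] : Prop :=
  ∀ A D U : Finset N, D ⊆ A → U ⊆ A → (∀ a ∈ A, ∀ d ∈ D, a ≤ d → a ∈ D) →
    (∀ a ∈ A, ∀ x ∈ U, x ≤ a → a ∈ U) → (∀ d ∈ D, ∀ x ∈ U, d < x) →
    ∃ z, ∀ a ∈ A, (a ≤ z ↔ a ∈ D) ∧ (z ≤ a ↔ a ∈ U)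

/-- A finite approximation to a poset on `α`: only the restriction of the order `ord` to the finite
set `carrier` carries information. -/
structure OrderCondition (α : Type*) where
  /-- The finite set on which the order has been decided. -/
  carrier : Finset α
  /-- A partial order of `α` that agrees on `carrier` with the order being approximated. -/
  ord : PartialOrder α

namespace OrderCondition

variable {α : Type*}

instance : Preorder (OrderCondition α) where
  le c c' := c.carrier ⊆ c'.carrier ∧
    ∀ a ∈ c.carrier, ∀ b ∈ c.carrier, (c.ord.le a b ↔ c'.ord.le a b)
  le_refl c := ⟨subset_rfl, fun _ _ _ _ => Iff.rfl⟩
  le_trans a b c hab hbc := ⟨hab.1.trans hbc.1, fun x hx y hy =>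
    (hab.2 x hx y hy).trans (hbc.2 x (hab.1 hx) y (hab.1 hy))⟩

/-- The task `(A, D, U)` is completed in `c`: `A` has been decided, and the one-point extension
described by `(A, D, U)` is realized if it is admissible. -/
def Completes (c : OrderCondition α) (t : Finset α × Finset α × Finset α) : Prop :=
  t.1 ⊆ c.carrier ∧ (t.2.1 ⊆ t.1 → t.2.2 ⊆ t.1 →
    (∀ a ∈ t.1, ∀ d ∈ t.2.1, c.ord.le a d → a ∈ t.2.1) →
    (∀ a ∈ t.1, ∀ x ∈ t.2.2, c.ord.le x a → a ∈ t.2.2) →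
    (∀ d ∈ t.2.1, ∀ x ∈ t.2.2, c.ord.le d x ∧ d ≠ x) →
    ∃ z ∈ c.carrier, ∀ a ∈ t.1, (c.ord.le a z ↔ a ∈ t.2.1) ∧ (c.ord.le z a ↔ a ∈ t.2.2))

/-- Free one-point extension: a new point `z` is placed above the points below some element of `D`
and below the points above some element of `U`. -/
theorem exists_le_realizing [Infinite α] (c : OrderCondition α) (D U : Finset α)
    (hDU : ∀ d ∈ D, ∀ x ∈ U, c.ord.le d x ∧ d ≠ x) :
    ∃ c' : OrderCondition α, c ≤ c' ∧ ∃ z ∈ c'.carrier, ∀ a ∈ c.carrier,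
      (c'.ord.le a z ↔ ∃ d ∈ D, c.ord.le a d) ∧ (c'.ord.le z a ↔ ∃ x ∈ U, c.ord.le x a) := by
  classical
  obtain ⟨z, hz⟩ := Infinite.exists_notMem_finset c.carrier
  have hrefl : ∀ a, c.ord.le a a := c.ord.le_refl
  have htrans : ∀ a b d, c.ord.le a b → c.ord.le b d → c.ord.le a d := fun a b d =>
    c.ord.le_trans a b d
  have hanti : ∀ a b, c.ord.le a b → c.ord.le b a → a = b := fun a b => c.ord.le_antisymm a b
  let r : α → α → Prop := fun a b => a = b ∨ (a ∈ c.carrier ∧ b ∈ c.carrier ∧ c.ord.le a b) ∨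
    (a ∈ c.carrier ∧ b = z ∧ ∃ d ∈ D, c.ord.le a d) ∨
    (a = z ∧ b ∈ c.carrier ∧ ∃ x ∈ U, c.ord.le x b)
  have h₁ : ∀ a ∈ c.carrier, ∀ b ∈ c.carrier, (c.ord.le a b ↔ r a b) := by
    simp only [r]
    grind
  have h₂ : ∀ a ∈ c.carrier, (r a z ↔ ∃ d ∈ D, c.ord.le a d) := by
    simp only [r]
    grind
  have h₃ : ∀ a ∈ c.carrier, (r z a ↔ ∃ x ∈ U, c.ord.le x a) := by
    simp only [r]
    grind
  let ord : PartialOrder α :=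
    { le := r
      le_refl := fun a => Or.inl rfl
      le_trans := by
        rintro a b e (hab | ⟨ha, hb, hab⟩ | ⟨ha, hb, d, hd, had⟩ | ⟨ha, hb, x, hx, hxb⟩)
          (h | ⟨hb', he, hbe⟩ | ⟨hb', he, d', hd', hbd⟩ | ⟨hb', he, x', hx', hxe⟩) <;>
          simp only [r] <;> grind
      le_antisymm := by
        rintro a b (hab | ⟨ha, hb, hab⟩ | ⟨ha, hb, d, hd, had⟩ | ⟨ha, hb, x, hx, hxb⟩)
          (h | ⟨hb', he, hbe⟩ | ⟨hb', h, d', hd', hbd⟩ | ⟨h, he, x', hx', hxe⟩) <;> grind }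
  exact ⟨⟨insert z c.carrier, ord⟩, ⟨Finset.subset_insert _ _, h₁⟩, z,
    Finset.mem_insert_self _ _, fun a ha => ⟨h₂ a ha, h₃ a ha⟩⟩

theorem isCofinal_completes [Infinite α] (t : Finset α × Finset α × Finset α) :
    IsCofinal {c : OrderCondition α | c.Completes t} := by
  classical
  obtain ⟨A, D, U⟩ := t
  intro c
  let c₁ : OrderCondition α := ⟨c.carrier ∪ A, c.ord⟩
  have hc₁ : c ≤ c₁ := ⟨Finset.subset_union_left, fun _ _ _ _ => Iff.rfl⟩
  have hA : A ⊆ c₁.carrier := Finset.subset_union_right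
  by_cases h : D ⊆ A ∧ U ⊆ A ∧ (∀ a ∈ A, ∀ d ∈ D, c.ord.le a d → a ∈ D) ∧
    (∀ a ∈ A, ∀ x ∈ U, c.ord.le x a → a ∈ U) ∧ (∀ d ∈ D, ∀ x ∈ U, c.ord.le d x ∧ d ≠ x)
  · obtain ⟨hD, hU, hDl, hUu, hDU⟩ := h
    obtain ⟨c₂, hc₂, z, hz, hzA⟩ := c₁.exists_le_realizing D U hDU
    refine ⟨c₂, ⟨hA.trans hc₂.1, fun _ _ _ _ _ => ⟨z, hz, fun a ha => ?_⟩⟩, hc₁.trans hc₂⟩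
    refine ⟨(hzA a (hA ha)).1.trans ⟨fun ⟨d, hd, had⟩ => hDl a ha d hd had, fun had => ?_⟩,
      (hzA a (hA ha)).2.trans ⟨fun ⟨x, hx, hxa⟩ => hUu a ha x hx hxa, fun hax => ?_⟩⟩
    · exact ⟨a, had, c.ord.le_refl a⟩
    · exact ⟨a, hax, c.ord.le_refl a⟩
  · exact ⟨c₁, ⟨hA, fun h₁ h₂ h₃ h₄ h₅ => absurd ⟨h₁, h₂, h₃, h₄, h₅⟩ h⟩, hc₁⟩

/-- By the Rasiowa–Sikorski lemma, the finite approximations in a sufficiently generic ideal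
amalgamate to a poset with the extension property. -/
theorem exists_hasPointExtensions (α : Type*) [Countable α] [Infinite α] :
    ∃ ord : PartialOrder α, @HasPointExtensions α ord := by
  classical
  let := Encodable.ofCountable (Finset α × Finset α × Finset α)
  let c₀ : OrderCondition α := ⟨∅, { le := Eq, le_refl := Eq.refl,
                                     le_trans := fun _ _ _ => Eq.trans,
                                     le_antisymm := fun _ _ h _ => h }⟩
  let 𝒟 : Finset α × Finset α × Finset α → Order.Cofinal (OrderCondition α) :=
    fun t => ⟨_, isCofinal_completes t⟩
  let I := Order.idealOfCofinals c₀ 𝒟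
  have hI : ∀ t, ∃ c ∈ I, c.Completes t := fun t =>
    let ⟨c, hc, hcI⟩ := Order.cofinal_meets_idealOfCofinals c₀ 𝒟 t
    ⟨c, hcI, hc⟩
  have hcover : ∀ A : Finset α, ∃ c ∈ I, A ⊆ c.carrier := fun A =>
    let ⟨c, hcI, hc⟩ := hI (A, ∅, ∅)
    ⟨c, hcI, hc.1⟩
  let r : α → α → Prop := fun a b => ∃ c ∈ I, a ∈ c.carrier ∧ b ∈ c.carrier ∧ c.ord.le a b
  have hr : ∀ c ∈ I, ∀ a ∈ c.carrier, ∀ b ∈ c.carrier, (r a b ↔ c.ord.le a b) := by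
    refine fun c hc a ha b hb => ⟨fun ⟨c', hc', ha', hb', hab⟩ => ?_, fun h => ⟨c, hc, ha, hb, h⟩⟩
    obtain ⟨c'', -, h₁, h₂⟩ := I.directed c hc c' hc'
    exact (h₁.2 a ha b hb).2 ((h₂.2 a ha' b hb').1 hab)
  let ord : PartialOrder α :=
    { le := r
      le_refl := fun a => by
        obtain ⟨c, hc, hA⟩ := hcover {a}
        exact (hr c hc a (hA (by simp)) a (hA (by simp))).2 (c.ord.le_refl a)
      le_trans := fun a b d hab hbd => by
        obtain ⟨c, hc, hA⟩ := hcover {a, b, d}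
        have ha : a ∈ c.carrier := hA (by simp)
        have hb : b ∈ c.carrier := hA (by simp)
        have hd : d ∈ c.carrier := hA (by simp)
        exact (hr c hc a ha d hd).2
          (c.ord.le_trans a b d ((hr c hc a ha b hb).1 hab) ((hr c hc b hb d hd).1 hbd))
      le_antisymm := fun a b hab hba => by
        obtain ⟨c, hc, hA⟩ := hcover {a, b}
        have ha : a ∈ c.carrier := hA (by simp)
        have hb : b ∈ c.carrier := hA (by simp)
        exact c.ord.le_antisymm a b ((hr c hc a ha b hb).1 hab) ((hr c hc b hb a ha).1 hba) }
  refine ⟨ord, fun A D U hD hU hDl hUu hDU => ?_⟩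
  obtain ⟨c, hc, hA, hz⟩ := hI (A, D, U)
  have hle : ∀ a ∈ c.carrier, ∀ b ∈ c.carrier, (ord.le a b ↔ c.ord.le a b) := hr c hc
  obtain ⟨z, hzc, hz⟩ := hz hD hU
    (fun a ha d hd had => hDl a ha d hd ((hle a (hA ha) d (hA (hD hd))).2 had))
    (fun a ha x hx hxa => hUu a ha x hx ((hle x (hA (hU hx)) a (hA ha)).2 hxa))
    (fun d hd x hx => ⟨(hle d (hA (hD hd)) x (hA (hU hx))).1 (hDU d hd x hx).le,
      (hDU d hd x hx).ne⟩)
  exact ⟨z, fun a ha => ⟨(hle a (hA ha) z hzc).trans (hz a ha).1,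
    (hle z hzc a (hA ha)).trans (hz a ha).2⟩⟩

end OrderCondition

theorem exists_countable_hasPointExtensions :
    ∃ (N : Type) (_ : PartialOrder N) (_ : Countable N), HasPointExtensions N :=
  let ⟨ord, h⟩ := OrderCondition.exists_hasPointExtensions ℕ
  ⟨ℕ, ord, inferInstance, h⟩

/-! ### The Fraïssé limit of the finite posets -/

theorem embedding_le_iff {F M N : Type*} [Language.order.Structure M] [Language.order.Structure N]
    [LE M] [LE N] [Language.order.OrderedStructure M] [Language.order.OrderedStructure N]
    [FunLike F M N] [Language.order.StrongHomClass F M N] (f : F) (a b : M) :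
    f a ≤ f b ↔ a ≤ b := by
  have h := StrongHomClass.map_rel f (leSymb : Language.order.Relations 2) ![a, b]
  simpa using h

/-- A finite partial embedding extends to a further point `m`: the image of `m` is a point cut out by
the images of the points below and above `m`. -/
theorem HasPointExtensions.isExtensionPair {M N : Type*} [Language.order.Structure M]
    [Language.order.Structure N] [PartialOrder M] [PartialOrder N]
    [Language.order.OrderedStructure M] [Language.order.OrderedStructure N]
    (hN : HasPointExtensions N) : Language.order.IsExtensionPair M N := by
  classical
  rw [isExtensionPair_iff_exists_embedding_closure_singleton_sup]
  intro S S_fg f m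
  have hmem : ∀ x, x ∈ closure Language.order {m} ⊔ S ↔ x = m ∨ x ∈ S := by
    intro x
    have h : closure Language.order {m} ⊔ S = closure Language.order ({m} ∪ (S : Set M)) := by
      rw [Substructure.closure_union, Substructure.closure_eq]
    rw [h, mem_closure_iff_of_isRelational]
    simp
  have hle : ∀ a b : S, f a ≤ f b ↔ a.1 ≤ b.1 := fun a b => embedding_le_iff f a b
  by_cases hm : m ∈ S
  · have hS : closure Language.order {m} ⊔ S ≤ S := fun x hx => by
      rcases (hmem x).1 hx with rfl | h
      exacts [hm, h]
    exact ⟨f.comp (inclusion hS), rfl⟩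
  have : Finite S := (S.fg_iff_structure_fg.1 S_fg).finite
  have := Fintype.ofFinite S
  obtain ⟨z, hz⟩ := hN (Finset.univ.image f) ((Finset.univ.filter fun s : S => s.1 ≤ m).image f)
    ((Finset.univ.filter fun s : S => m ≤ s.1).image f)
    (Finset.image_subset_image (Finset.subset_univ _))
    (Finset.image_subset_image (Finset.subset_univ _))
    (by
      simp only [Finset.mem_image, Finset.mem_filter, Finset.mem_univ, true_and]
      rintro _ ⟨a, rfl⟩ _ ⟨d, hd, rfl⟩ had
      exact ⟨a, ((hle a d).1 had).trans hd, rfl⟩)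
    (by
      simp only [Finset.mem_image, Finset.mem_filter, Finset.mem_univ, true_and]
      rintro _ ⟨a, rfl⟩ _ ⟨d, hd, rfl⟩ had
      exact ⟨a, hd.trans ((hle d a).1 had), rfl⟩)
    (by
      simp only [Finset.mem_image, Finset.mem_filter, Finset.mem_univ, true_and]
      rintro _ ⟨d, hd, rfl⟩ _ ⟨x, hx, rfl⟩
      refine lt_of_le_of_ne ((hle d x).2 (hd.trans hx)) fun h => hm ?_
      obtain rfl := f.injective h
      exact le_antisymm hd hx ▸ d.2)
  have hz' : ∀ s : S, (f s ≤ z ↔ s.1 ≤ m) ∧ (z ≤ f s ↔ m ≤ s.1) := by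
    intro s
    have h := hz (f s) (Finset.mem_image_of_mem _ (Finset.mem_univ s))
    simpa [f.injective.eq_iff] using h
  let g : ↥(closure Language.order {m} ⊔ S) ↪o N :=
    OrderEmbedding.ofMapLEIff (fun x => if hx : x.1 ∈ S then f ⟨x.1, hx⟩ else z) (by
      intro x y
      by_cases hx : x.1 ∈ S <;> by_cases hy : y.1 ∈ S
      · simp only [hx, hy, dif_pos]
        exact hle _ _
      · have hy' : y.1 = m := ((hmem _).1 y.2).resolve_right hy
        simp only [hx, hy, dif_pos, dif_neg, not_false_eq_true]
        exact (hz' _).1.trans (by rw [← Subtype.coe_le_coe, hy'])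
      · have hx' : x.1 = m := ((hmem _).1 x.2).resolve_right hx
        simp only [hx, hy, dif_pos, dif_neg, not_false_eq_true]
        exact (hz' _).2.trans (by rw [← Subtype.coe_le_coe, hx'])
      · have hx' : x.1 = m := ((hmem _).1 x.2).resolve_right hx
        have hy' : y.1 = m := ((hmem _).1 y.2).resolve_right hy
        simp only [hx, hy, dif_neg, not_false_eq_true, le_refl, true_iff]
        exact (hx'.trans hy'.symm).le)
  refine ⟨StrongHomClass.toEmbedding g, ?_⟩
  ext x
  change f x = if hx : x.1 ∈ S then f ⟨x.1, hx⟩ else z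
  simp

theorem HasPointExtensions.isFraisseLimit {N : Type} [Language.order.Structure N] [PartialOrder N]
    [Language.order.OrderedStructure N] [Countable N] (hN : HasPointExtensions N) :
    IsFraisseLimit finitePosets N where
  ultrahomogeneous :=
    (isUltrahomogeneous_iff_IsExtensionPair cg_of_countable).2 hN.isExtensionPair
  age := by
    ext S
    refine ⟨fun ⟨hF, h⟩ => ⟨hF.finite, Theory.IsUniversal.models_of_embedding h.some⟩,
      fun ⟨hF, h⟩ => ⟨FG.of_finite, ?_⟩⟩
    let := Language.order.partialOrderOfModels S
    obtain ⟨f, -⟩ := embedding_from_cg cg_of_countable default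
      (hN.isExtensionPair (M := S) (N := N))
    exact ⟨f⟩

theorem exists_isFraisseLimit_finitePosets :
    ∃ (M : Type) (_ : Language.order.Structure M) (_ : Countable M),
      IsFraisseLimit finitePosets M := by
  obtain ⟨N, _, _, hN⟩ := exists_countable_hasPointExtensions
  let := orderStructure N
  have : Language.order.OrderedStructure N := ⟨fun _ => Iff.rfl⟩
  exact ⟨N, inferInstance, inferInstance, hN.isFraisseLimit⟩

/-- By uniqueness of the Fraïssé limit, `M` is isomorphic to a poset with the extension property. -/
theorem IsFraisseLimit.models_partialOrderTheory {M : Type} [Language.order.Structure M]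
    [Countable M] (h : IsFraisseLimit finitePosets M) : M ⊨ Language.order.partialOrderTheory := by
  obtain ⟨N, _, _, hN⟩ := exists_countable_hasPointExtensions
  let := orderStructure N
  have : Language.order.OrderedStructure N := ⟨fun _ => Iff.rfl⟩
  obtain ⟨e⟩ := h.nonempty_equiv hN.isFraisseLimit
  exact Theory.IsUniversal.models_of_embedding e.toEmbedding

theorem IsFraisseLimit.exists_orderEmbedding {M : Type} [Language.order.Structure M]
    [PartialOrder M] [Language.order.OrderedStructure M] [Countable M]
    (h : IsFraisseLimit finitePosets M) (σ : Type) [PartialOrder σ] [Finite σ] :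
    Nonempty (σ ↪o M) := by
  let := orderStructure σ
  have : Language.order.OrderedStructure σ := ⟨fun _ => Iff.rfl⟩
  have hσ : (CategoryTheory.Bundled.of σ : CategoryTheory.Bundled Language.order.Structure) ∈
      finitePosets := ⟨‹_›, inferInstanceAs (σ ⊨ Language.order.partialOrderTheory)⟩
  rw [← h.age] at hσ
  obtain ⟨-, ⟨f⟩⟩ := hσ
  exact ⟨OrderEmbedding.ofMapLEIff f fun a b => embedding_le_iff (M := σ) f a b⟩

theorem IsFraisseLimit.nonempty_of_finitePosets {M : Type} [Language.order.Structure M]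
    [Countable M] (h : IsFraisseLimit finitePosets M) : Nonempty M := by
  have := h.models_partialOrderTheory
  let := Language.order.partialOrderOfModels M
  exact (h.exists_orderEmbedding PUnit).map fun e => e ⟨⟩

/-- The formula `x ≤ y` has `SUP`: every finite poset embeds into `M`, and in a poset `d ≤ d'` holds
exactly when every point below `d` is below `d'`. -/
theorem IsFraisseLimit.hasSUP {M : Type} [Language.order.Structure M] [Countable M]
    (h : IsFraisseLimit finitePosets M) : (Language.order.completeTheory M).HasSUP := by
  have := h.models_partialOrderTheory
  let := Language.order.partialOrderOfModels M
  have := h.nonempty_of_finitePosets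
  refine ⟨1, 1, (Term.var (Sum.inl (Sum.inl 0))).le (Term.var (Sum.inl (Sum.inr 0))),
    Theory.ModelType.of _ M, fun σ _ => ?_⟩
  obtain ⟨e⟩ := h.exists_orderEmbedding σ
  refine ⟨fun s _ => e s, fun s t => ?_⟩
  have key : ∀ (x y : Fin 1 → M), Formula.Realize (L := Language.order)
      ((Term.var (Sum.inl (Sum.inl 0))).le (Term.var (Sum.inl (Sum.inr 0))))
      (Sum.elim x y) ↔ x 0 ≤ y 0 := by
    intro x y
    rw [Formula.Realize, Term.realize_le]
    rfl
  rw [← e.le_iff_le]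
  exact ⟨fun hx => (key _ _).1 (hx (fun _ => e s) ((key _ _).2 le_rfl)),
    fun hst x hx => (key _ _).2 (((key _ _).1 hx).trans hst)⟩

/-! ### Quantifier elimination -/

/-- Tuples with the same order diagram are conjugate under an automorphism, hence satisfy the same
formulas. -/
theorem IsUltrahomogeneous.realize_iff {M : Type*} [Language.order.Structure M] [PartialOrder M]
    [Language.order.OrderedStructure M] (h : Language.order.IsUltrahomogeneous M) {α : Type*}
    [Finite α] (φ : Language.order.Formula α) (v w : α → M)
    (hvw : ∀ i j, v i ≤ v j ↔ w i ≤ w j) : φ.Realize v ↔ φ.Realize w := by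
  let S := closure Language.order (Set.range v)
  have hS : ∀ x : S, ∃ i, v i = x := fun x =>
    (mem_closure_iff_of_isRelational Language.order (Set.range v) x.1).1 x.2
  choose i hi using hS
  let f : S ↪o M := OrderEmbedding.ofMapLEIff (fun x => w (i x)) fun x y => by
    rw [← hvw, hi, hi]
    rfl
  obtain ⟨g, hg⟩ := h S (fg_closure (Set.finite_range v)) (StrongHomClass.toEmbedding f)
  have hgv : ⇑g ∘ v = w := by
    ext j
    have hj : v j ∈ S := subset_closure ⟨j, rfl⟩
    have h₁ : w (i ⟨v j, hj⟩) = g (v j) := DFunLike.congr_fun hg (⟨v j, hj⟩ : S)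
    have h₂ : v (i ⟨v j, hj⟩) = v j := hi ⟨v j, hj⟩
    rw [Function.comp_apply, ← h₁]
    exact le_antisymm ((hvw _ _).1 h₂.le) ((hvw _ _).1 h₂.ge)
  rw [← hgv, StrongHomClass.realize_formula]

theorem BoundedFormula.IsQF.iSup {L : Language.{u, v}} {α : Type*} {n : ℕ} {β : Type*} [Finite β]
    {f : β → L.BoundedFormula α n} (hf : ∀ b, (f b).IsQF) : (BoundedFormula.iSup f).IsQF := by
  rw [BoundedFormula.iSup]
  generalize Finset.toList _ = l
  induction l with
  | nil => exact isQF_bot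
  | cons b l ih => exact (hf b).sup ih

theorem BoundedFormula.IsQF.iInf {L : Language.{u, v}} {α : Type*} {n : ℕ} {β : Type*} [Finite β]
    {f : β → L.BoundedFormula α n} (hf : ∀ b, (f b).IsQF) : (BoundedFormula.iInf f).IsQF := by
  rw [BoundedFormula.iInf]
  generalize Finset.toList _ = l
  induction l with
  | nil => exact .top
  | cons b l ih => exact (hf b).inf ih

/-- A formula is equivalent to the disjunction of the order diagrams of the tuples satisfying it. -/
theorem IsUltrahomogeneous.exists_isQF {M : Type*} [Language.order.Structure M] [PartialOrder M]
    [Language.order.OrderedStructure M] (h : Language.order.IsUltrahomogeneous M) {α : Type*}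
    [Finite α] (φ : Language.order.Formula α) :
    ∃ ψ : Language.order.Formula α, ψ.IsQF ∧ ∀ v : α → M, φ.Realize v ↔ ψ.Realize v := by
  classical
  let lit : (α × α → Prop) → α × α → Language.order.Formula α := fun R p =>
    if R p then (Term.var (Sum.inl p.1)).le (Term.var (Sum.inl p.2))
    else ((Term.var (Sum.inl p.1)).le (Term.var (Sum.inl p.2))).not
  have hlit : ∀ R p, (lit R p).IsQF := by
    intro R p
    have hat : BoundedFormula.IsQF
        ((Term.var (Sum.inl p.1)).le (Term.var (Sum.inl p.2)) : Language.order.Formula α) :=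
      (BoundedFormula.IsAtomic.rel _ _).isQF
    simp only [lit]
    split_ifs
    exacts [hat, hat.not]
  have hreal : ∀ R p (v : α → M), (lit R p).Realize v ↔ (R p ↔ v p.1 ≤ v p.2) := by
    intro R p v
    simp only [lit]
    split_ifs with hR
    · rw [Formula.Realize, Term.realize_le]
      simp [hR]
    · rw [Formula.realize_not, Formula.Realize, Term.realize_le]
      simp [hR]
  refine ⟨BoundedFormula.iSup fun R : {R : α × α → Prop //
    ∃ v : α → M, φ.Realize v ∧ ∀ p, R p ↔ v p.1 ≤ v p.2} => BoundedFormula.iInf (lit R.1),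
    .iSup fun R => .iInf (hlit R.1), fun v => ?_⟩
  rw [Formula.Realize, Formula.Realize, BoundedFormula.realize_iSup]
  simp only [BoundedFormula.realize_iInf]
  constructor
  · exact fun hv => ⟨⟨fun p => v p.1 ≤ v p.2, v, hv, fun _ => Iff.rfl⟩,
      fun p => (hreal _ p v).2 Iff.rfl⟩
  · rintro ⟨⟨R, w, hw, hR⟩, hv⟩
    exact (h.realize_iff φ v w fun i j => ((hreal R (i, j) v).1 (hv (i, j))).symm.trans
      (hR (i, j))).2 hw

theorem IsUltrahomogeneous.hasQE {M : Type} [Language.order.Structure M] [PartialOrder M]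
    [Language.order.OrderedStructure M] (h : Language.order.IsUltrahomogeneous M) :
    (Language.order.completeTheory M).HasQE := by
  intro n φ
  obtain ⟨ψ, hψ, hM⟩ := h.exists_isQF φ
  refine ⟨ψ, hψ, Theory.models_formula_iff.2 fun N v => ?_⟩
  -- the equivalence holds in `M`, so its universal closure belongs to the complete theory
  let χ : Language.order.Sentence :=
    Formula.iAlls (Fin n) ((φ.iff ψ).relabel (Sum.inr : Fin n → Empty ⊕ Fin n))
  have hχ : ∀ (N : Type) [Language.order.Structure N], N ⊨ χ ↔
      ∀ v : Fin n → N, (φ.iff ψ).Realize v := by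
    intro N _
    simp only [χ, Sentence.Realize, Formula.realize_iAlls, Formula.realize_relabel]
    rfl
  have hχM : χ ∈ Language.order.completeTheory M := by
    rw [mem_completeTheory, hχ]
    exact fun v => Formula.realize_iff.2 (hM v)
  exact (hχ N).1 (Theory.realize_sentence_of_mem _ hχM) v

/-! ### The failure of `IP₂` -/

/-- In the language of orders, the truth of a quantifier-free formula depends only on the equalities
and the relations `≤` between the values of pairs of variables. -/
theorem BoundedFormula.IsQF.realize_iff_of_pattern {M : Type*} [Language.order.Structure M] [LE M]
    [Language.order.OrderedStructure M] {α : Type*} {φ : Language.order.Formula α} (hφ : φ.IsQF)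
    (v w : α → M) (heq : ∀ i j, v i = v j ↔ w i = w j) (hle : ∀ i j, v i ≤ v j ↔ w i ≤ w j) :
    φ.Realize v ↔ φ.Realize w := by
  have hterm : ∀ t : Language.order.Term (α ⊕ Fin 0), ∃ i, t = Term.var (Sum.inl i) := by
    rintro (x | ⟨f, -⟩)
    · rcases x with i | i
      exacts [⟨i, rfl⟩, i.elim0]
    · exact isEmptyElim f
  rw [Formula.Realize, Formula.Realize]
  induction hφ with
  | falsum => rfl
  | of_isAtomic h =>
    cases h with
    | equal t₁ t₂ =>
      obtain ⟨i, rfl⟩ := hterm t₁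
      obtain ⟨j, rfl⟩ := hterm t₂
      simpa using heq i j
    | @rel l R ts =>
      rw [BoundedFormula.realize_rel, BoundedFormula.realize_rel]
      obtain ⟨⟩ : l = 2 := by cases R; rfl
      obtain ⟨i, hi⟩ := hterm (ts 0)
      obtain ⟨j, hj⟩ := hterm (ts 1)
      rw [order.relation_eq_leSymb R, relMap_leSymb, relMap_leSymb]
      simpa [hi, hj] using hle i j
  | imp _ _ h₁ h₂ => exact imp_congr h₁ h₂

/-- A theory of a binary relation with quantifier elimination is `NIP₂`: for a set
`W ⊆ N × N`, the truth values of `φ(a_W; b_i, c_j)` are determined by the `2 N` quantifier-free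
types of the pairs `(a_W, b_i)` and `(a_W, c_j)`, which take fewer than `2 ^ (N * N)`
values when `N` is large. -/
theorem Theory.HasQE.not_hasIPk_two {T : Language.order.Theory} (hT : T.HasQE) :
    ¬ T.HasIPk 2 := by
  classical
  rintro ⟨n, m, φ, M, b, a, h⟩
  let := Language.order.leOfStructure M
  obtain ⟨k, ⟨e⟩⟩ := Finite.exists_equiv_fin (Fin n ⊕ (Σ j : Fin 2, Fin (m j)))
  obtain ⟨ψ, hψ, hφψ⟩ := hT k (φ.relabel e)
  have hreal : ∀ v : Fin n ⊕ (Σ j : Fin 2, Fin (m j)) → M,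
      φ.Realize v ↔ ψ.Realize (v ∘ e.symm) := by
    intro v
    have := Formula.realize_iff.1 (Theory.models_formula_iff.1 hφψ M (v ∘ e.symm))
    rwa [Formula.realize_relabel, Function.comp_assoc, _root_.Equiv.symm_comp_self,
      Function.comp_id] at this
  -- the possible quantifier-free types of a tuple `x` together with a tuple `y_j`, for both `j`
  let Q : Type := ∀ j : Fin 2, Fin n ⊕ Fin (m j) → Fin n ⊕ Fin (m j) → Prop × Prop
  let N := Fintype.card Q
  have hN : 0 < N := Fintype.card_pos
  -- subsets of `N × N`, read as subsets of `ℕ × ℕ`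
  let ext : Set (Fin 2 → Fin N) → Set (Fin 2 → ℕ) := fun W => (fun i j => (i j : ℕ)) '' W
  let pat : Set (Fin 2 → Fin N) → Fin N → Q := fun W i j p q =>
    (Sum.elim (a (ext W)) (b j i) p = Sum.elim (a (ext W)) (b j i) q,
      Sum.elim (a (ext W)) (b j i) p ≤ Sum.elim (a (ext W)) (b j i) q)
  -- the quantifier-free types of `(a_W, b_i)` and `(a_W, c_i)` for all `i < N` determine `W`
  have hinj : Function.Injective pat := by
    intro V W hVW
    have hpat : ∀ i j p q,
        (Sum.elim (a (ext V)) (b j (i : Fin N)) p = Sum.elim (a (ext V)) (b j i) q ↔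
          Sum.elim (a (ext W)) (b j i) p = Sum.elim (a (ext W)) (b j i) q) ∧
        (Sum.elim (a (ext V)) (b j i) p ≤ Sum.elim (a (ext V)) (b j i) q ↔
          Sum.elim (a (ext W)) (b j i) p ≤ Sum.elim (a (ext W)) (b j i) q) := by
      intro i j p q
      have := congr_fun (congr_fun (congr_fun (congr_fun hVW i) j) p) q
      exact ⟨iff_of_eq (congr_arg Prod.fst this), iff_of_eq (congr_arg Prod.snd this)⟩
    ext i
    have hext : ∀ W, (fun j => (i j : ℕ)) ∈ ext W ↔ i ∈ W := by
      intro W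
      refine ⟨fun ⟨i', hi', hii⟩ => ?_, fun hi => ⟨i, hi, rfl⟩⟩
      have : i' = i := funext fun j => Fin.ext (congr_fun hii j)
      exact this ▸ hi'
    rw [← hext V, ← hext W, ← h, ← h, hreal, hreal]
    -- two variables that do not both lie in `x, y_0` or in `x, y_1` have values not depending on `W`
    let val (W) : Fin n ⊕ (Σ j : Fin 2, Fin (m j)) → M :=
      Sum.elim (a (ext W)) fun p => b p.1 (i p.1) p.2
    have hall : ∀ p q, (val V p = val V q ↔ val W p = val W q) ∧
        (val V p ≤ val V q ↔ val W p ≤ val W q) := by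
      rintro (p | ⟨j, p⟩) (q | ⟨l, q⟩)
      · exact hpat (i 0) 0 (Sum.inl p) (Sum.inl q)
      · exact hpat (i l) l (Sum.inl p) (Sum.inr q)
      · exact hpat (i j) j (Sum.inr p) (Sum.inl q)
      · exact ⟨Iff.rfl, Iff.rfl⟩
    exact hψ.realize_iff_of_pattern _ _ (fun p q => (hall _ _).1) (fun p q => (hall _ _).2)
  have hcard := Fintype.card_le_of_injective pat hinj
  have h₁ : Fintype.card (Set (Fin 2 → Fin N)) = (2 ^ N) ^ N := by
    rw [Fintype.card_set, Fintype.card_fun, Fintype.card_fin, Fintype.card_fin, ← pow_mul, sq]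
  have h₂ : Fintype.card (Fin N → Q) = N ^ N := by
    rw [Fintype.card_fun, Fintype.card_fin]
  rw [h₁, h₂] at hcard
  exact absurd hcard (not_le.2 (Nat.pow_lt_pow_left Nat.lt_two_pow_self hN.ne'))

end FirstOrder.Language

theorem mainTheorem5 :
    -- general implications, for an arbitrary complete theory
    (∀ (L : FirstOrder.Language.{u, v}) (T : L.Theory), T.IsComplete →
      -- the usual strict order property as an instance of the family
      [ T.HasSOP,
        T.HasSOPFor FirstOrder.Language.Theory.finiteLinearOrders,
        ∃ (S : Type w) (_ : LinearOrder S), Infinite S ∧ T.HasSOPOf S,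
        ∀ (S : Type w) [LinearOrder S] [Infinite S], T.HasSOPOf S ].TFAE ∧
      -- SUP implies every property of the family, formula by formula
      (∀ (n m : ℕ) (ψ : L.Formula (Fin n ⊕ Fin m)),
        T.FormulaHasSOPFor (Set.univ : Set FinPartOrd.{0}) ψ →
          ∀ K : Set FinPartOrd.{w}, T.FormulaHasSOPFor K ψ) ∧
      (T.HasSUP →
        (∀ K : Set FinPartOrd.{w}, T.HasSOPFor K) ∧
          T.HasSOP ∧ T.HasTP₁ ∧ T.HasATP ∧ T.HasTP₂ ∧ T.HasIP)) ∧
    -- the generic poset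
    (FirstOrder.Language.IsFraisse FirstOrder.Language.finitePosets ∧
      (∃ (M : Type) (_ : FirstOrder.Language.order.Structure M) (_ : Countable M),
        FirstOrder.Language.IsFraisseLimit FirstOrder.Language.finitePosets M) ∧
      (∀ (M : Type) [FirstOrder.Language.order.Structure M] [Countable M],
        FirstOrder.Language.IsFraisseLimit FirstOrder.Language.finitePosets M →
          (FirstOrder.Language.order.completeTheory M).HasQE ∧
          (FirstOrder.Language.order.completeTheory M).HasSUP ∧
          ¬ (FirstOrder.Language.order.completeTheory M).HasIPk 2)) ∧
    -- no property of the family implies `IP₂`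
    (∀ K : Set FinPartOrd.{w},
      ¬ ∀ (L : FirstOrder.Language.{0, 0}) (T : L.Theory), T.IsComplete →
          T.HasSOPFor K → T.HasIPk 2) := by
  obtain ⟨G, _, _, hG⟩ := FirstOrder.Language.exists_isFraisseLimit_finitePosets
  have hQE : ∀ (M : Type) [FirstOrder.Language.order.Structure M] [Countable M],
      FirstOrder.Language.IsFraisseLimit FirstOrder.Language.finitePosets M →
        (FirstOrder.Language.order.completeTheory M).HasQE := by
    intro M _ _ hM
    have := hM.models_partialOrderTheory
    let := FirstOrder.Language.order.partialOrderOfModels M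
    exact hM.ultrahomogeneous.hasQE
  refine ⟨fun L T _ => ⟨T.hasSOP_tfae, fun n m ψ hψ K => hψ.of_univ K, fun h =>
    ⟨h.hasSOPFor, h.hasSOP, h.hasTP₁, h.hasATP, h.hasTP₂, h.hasIP⟩⟩,
    ⟨hG.isFraisse, ⟨G, _, _, hG⟩, fun M _ _ hM => ⟨hQE M hM, hM.hasSUP, (hQE M hM).not_hasIPk_two⟩⟩,
    fun K h => ?_⟩
  have : Nonempty G := hG.nonempty_of_finitePosets
  exact (hQE G hG).not_hasIPk_two (h _ _ (FirstOrder.Language.completeTheory.isComplete _ G)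
    (hG.hasSUP.hasSOPFor K))
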